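/- Let $0\le l\le n$ and $k\ge 0$ be integers. Let $\mathcal H_l^{(n)}$ be the complex Hilbert space with orthonormal basis $|x\rangle$, where $x$ runs over the binary strings of length $n$ with exactly $l$ ones, let $d$ be the Hamming distance, and let $$A_k^{(l)}=\sum_{x,y:\ d(x,y)=2k}|x\rangle\langle y|$$ be the corresponding operator on $\mathcal H_l^{(n)}$. Let $S_n$ act on $\mathcal H_l^{(n)}$ by $V_\pi|x_1\ldots x_n\rangle=|x_{\pi(1)}\ldots x_{\pi(n)}\rangle$. For $0\le j\le\min\{l,n-l\}$ let $\tilde P_j=\frac{f_j}{n!}\,\mathsf A\,\mathsf S$ be the Young symmetrizer of the tableau with rows $(1,\ldots,n-j)$ and $(n-j+1,\ldots,n)$, where $f_j=\binom nj\frac{n-2j+1}{n-j+1}$, $\mathsf S$ is the sum of the $V_\pi$ over all $\pi$ preserving each row, and $\mathsf A$ is the sum of the $\operatorname{sgn}(\pi)V_\pi$ over all $\pi$ preserving each column. Let $B_j\subseteq\mathcal H_l^{(n)}$ be the component belonging to the irreducible representation of $S_n$ labelled by the partition $(n-j,j)$, that is, the linear span of all vectors $V_\pi\tilde P_j\psi$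 with $\pi\in S_n$ and $\psi\in\mathcal H_l^{(n)}$, and let $P_j$ be the orthogonal projector onto $B_j$. Put $$\alpha_k(j)=\sum_{r=\max\{0,k-j\}}^{\min\{k,l-j\}}(-1)^{k-r}\binom{l-j+k-r}{k}\binom{n-l-k+r}{r}\binom{j}{k-r},$$ where an empty sum is $0$. Then the spaces $B_j$, $0\le j\le\min\{l,n-l\}$, are nonzero and mutually orthogonal, their sum is $\mathcal H_l^{(n)}$, the operator $A_k^{(l)}$ acts on $B_j$ as multiplication by $\alpha_k(j)$, and hence $$A_k^{(l)}=\sum_{j=0}^{\min\{l,n-l\}}\alpha_k(j)\,P_j .$$ In particular, the eigenvalues of $A_k^{(l)}$ are exactly the numbers $\alpha_k(j)$, $0\le j\le\min\{l,n-l\}$. -/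

import Mathlib

/-- Binary strings `x = x₁ … xₙ` of length `n` with exactly `l` ones. -/
abbrev WeightString (n l : ℕ) : Type :=
  {x : Fin n → Fin 2 // hammingNorm x = l}

/-- The Hilbert space `H_l^{(n)}`: the span of the standard basis vectors `|x⟩` of the `n`-qubit
space, where `x` runs over the binary strings with exactly `l` ones (an orthonormal basis). -/
abbrev WeightSpace (n l : ℕ) : Type := EuclideanSpace ℂ (WeightString n l)

/-- The operator `A_k^{(l)} = ∑_{x, y : d(x, y) = 2k} |x⟩⟨y|` on `H_l^{(n)}`, where `d` is the
Hamming distance. -/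
noncomputable def distOp (n l k : ℕ) : WeightSpace n l →ₗ[ℂ] WeightSpace n l :=
  Matrix.toEuclideanLin
    (Matrix.of fun x y : WeightString n l => if hammingDist x.1 y.1 = 2 * k then (1 : ℂ) else 0)

theorem hammingNorm_comp_perm {n : ℕ} (π : Equiv.Perm (Fin n)) (x : Fin n → Fin 2) :
    hammingNorm (fun i => x (π i)) = hammingNorm x := by
  unfold hammingNorm
  exact Finset.card_bij (fun i _ => π i) (by simp) (by simp)
    (fun b hb => ⟨π.symm b, by simpa using hb, by simp⟩)

/-- Permutation of the places of a string: `x₁ … xₙ ↦ x_{π(1)} … x_{π(n)}`. -/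
def permString {n l : ℕ} (π : Equiv.Perm (Fin n)) : WeightString n l ≃ WeightString n l where
  toFun x := ⟨fun i => x.1 (π i), (hammingNorm_comp_perm π x.1).trans x.2⟩
  invFun x := ⟨fun i => x.1 (π.symm i), (hammingNorm_comp_perm π.symm x.1).trans x.2⟩
  left_inv x := by ext i; simp
  right_inv x := by ext i; simp

/-- The operator `V_π` on `H_l^{(n)}`, with `V_π |x₁ … xₙ⟩ = |x_{π(1)} … x_{π(n)}⟩`. -/
noncomputable def permOp {n l : ℕ} (π : Equiv.Perm (Fin n)) :
    WeightSpace n l →ₗ[ℂ] WeightSpace n l :=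
  (LinearIsometryEquiv.piLpCongrLeft 2 ℂ ℂ (permString π)).toLinearEquiv.toLinearMap

theorem permOp_single {n l : ℕ} (π : Equiv.Perm (Fin n)) (x : WeightString n l) :
    permOp π (EuclideanSpace.single x (1 : ℂ)) = EuclideanSpace.single (permString π x) 1 :=
  LinearIsometryEquiv.piLpCongrLeft_single (permString π) x 1

/-- The row (`0` or `1`) that contains the entry `i` in the standard tableau of shape `(n - j, j)`
whose first row is `1, …, n - j` and whose second row is `n - j + 1, …, n`
(the entries are numbered from `0` here). -/
def tableauRow (n j : ℕ) (i : Fin n) : ℕ := if (i : ℕ) < n - j then 0 else 1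

/-- The column (numbered from `0`) that contains the entry `i` in the same tableau. -/
def tableauCol (n j : ℕ) (i : Fin n) : ℕ := if (i : ℕ) < n - j then i else i - (n - j)

open Classical in
/-- The product over the rows of the tableau of the symmetrizers `∑ V_π` of the rows: the sum of
`V_π` over all permutations `π` that preserve every row. -/
noncomputable def rowSymmetrizer (n l j : ℕ) : WeightSpace n l →ₗ[ℂ] WeightSpace n l :=
  ∑ π : Equiv.Perm (Fin n) with ∀ i, tableauRow n j (π i) = tableauRow n j i, permOp π

open Classical in
/-- The product over the columns of the tableau of the antisymmetrizers `∑ sgn(π) V_π` of the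
columns: the signed sum of `V_π` over all permutations `π` that preserve every column. -/
noncomputable def colAntisymmetrizer (n l j : ℕ) : WeightSpace n l →ₗ[ℂ] WeightSpace n l :=
  ∑ π : Equiv.Perm (Fin n) with ∀ i, tableauCol n j (π i) = tableauCol n j i,
    ((Equiv.Perm.sign π : ℤ) : ℂ) • permOp π

/-- The dimension `f_j = C(n, j) (n - 2j + 1) / (n - j + 1)` of the irreducible representation of
`S_n` labelled by the partition `(n - j, j)`. -/
noncomputable def irrepDim (n j : ℕ) : ℂ :=
  (n.choose j : ℂ) * ((n : ℂ) - 2 * j + 1) / ((n : ℂ) - j + 1)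

/-- The Young symmetrizer of the tableau above: `f_j / n!` times the column antisymmetrizer
times the row symmetrizer. -/
noncomputable def youngSymmetrizer (n l j : ℕ) : WeightSpace n l →ₗ[ℂ] WeightSpace n l :=
  (irrepDim n j / (n.factorial : ℂ)) • (colAntisymmetrizer n l j ∘ₗ rowSymmetrizer n l j)

/-- The part `B_j` of `H_l^{(n)}` that belongs to the irreducible representation of `S_n` labelled
by `(n - j, j)`: the subrepresentation generated by the image of the Young symmetrizer (every other
tableau of that shape is a permutation of the chosen one, so this contains the images of the Young
symmetrizers of all of them). -/
noncomputable def irrepPart (n l j : ℕ) : Submodule ℂ (WeightSpace n l) :=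
  Submodule.span ℂ
    {v | ∃ (π : Equiv.Perm (Fin n)) (ψ : WeightSpace n l), v = permOp π (youngSymmetrizer n l j ψ)}

/-- The number `α_k(j) = ∑_r (-1)^(k-r) C(l-j+k-r, k) C(n-l-k+r, r) C(j, k-r)`, the sum running
over `max(0, k-j) ≤ r ≤ min(k, l-j)`. For `j ≤ min(l, n-l)` and `r` in this range none of the
differences below is truncated, apart from the lower limit `k - j`, which is `max(0, k-j)`. -/
def eigFormula (n l k j : ℕ) : ℤ :=
  ∑ r ∈ Finset.Icc (k - j) (min k (l - j)),
    (-1 : ℤ) ^ (k - r) * ((l - j + k - r).choose k : ℤ) * ((n - l + r - k).choose r : ℤ)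
      * (j.choose (k - r) : ℤ)

/-! Fix `j` disjoint pairs of places. A vector odd under the swap inside each pair and invariant
under swaps of the remaining places is unique up to a scalar (`apply_mul_apply_comm`): it is a
multiple of `pairVec`, singlets on the pairs times the uniform sum elsewhere. Images of the Young
symmetrizer have these symmetries and one of them is nonzero, so `B_j` is spanned by the permuted
copies of one `pairVec` (`irrepPart_eq_span`).

The operator `A_k` commutes with permutations and so preserves the symmetries; hence `pairVec` is an
eigenvector. Its eigenvalue is the entry of `A_k pairVec` at `1…10…0`, where `pairVec` equals 1.
That entry is a signed count of pairs of `k`-subsets, an Eberlein number with generating function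
`(1 - t)^j ∑ C(a, m) C(b, m) t^m`; Pascal's rule turns it into `α_k(j)`.

Since `A_1` is symmetric and the `α_1(j)` are distinct, the `B_j` are orthogonal. They exhaust the
space because a nonzero vector orthogonal to all of them could be antisymmetrized in ever more
disjoint pairs (`PairAntisymm.eq_zero_of_orthogonal`). -/

/-! ### Eberlein numbers -/

/-- The Eberlein numbers `∑ₛ (-1)^s C(j, s) C(a, k - s) C(b, k - s)`, defined by their recursion
in `j`. -/
def eberlein (a b : ℕ) : ℕ → ℕ → ℤ
  | 0, k => (a.choose k : ℤ) * (b.choose k : ℤ)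
  | j + 1, 0 => eberlein a b j 0
  | j + 1, k + 1 => eberlein a b j (k + 1) - eberlein a b j k

theorem eberlein_zero_right (a b j : ℕ) : eberlein a b j 0 = 1 := by
  induction j with
  | zero => simp [eberlein]
  | succ j ih => simpa [eberlein] using ih

theorem eberlein_one_right (a b j : ℕ) : eberlein a b j 1 = (a : ℤ) * b - j := by
  induction j with
  | zero => simp [eberlein]
  | succ j ih =>
    rw [eberlein, ih, eberlein_zero_right]
    push_cast
    ring

/-- Induction on `j` with Pascal's rule applied to each of the three binomials in turn: `hR` splits
`C(j+1, s)`, `hP` splits `C(b+j+1-s, k+1-s)`, and the last step splits `C(a+s+1, k+1)`. -/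
theorem eberlein_eq_sum (a b j k : ℕ) :
    eberlein a b j k = ∑ s ∈ Finset.range (k + 1),
      (-1 : ℤ) ^ s * (j.choose s : ℤ) * ((a + s).choose k : ℤ) *
        ((b + j - s).choose (k - s) : ℤ) := by
  induction j generalizing k with
  | zero =>
    rw [Finset.sum_eq_single_of_mem 0 (by simp)]
    · simp [eberlein]
    · intro s _ hs
      simp [Nat.choose_eq_zero_of_lt (Nat.pos_of_ne_zero hs)]
  | succ j ih =>
    cases k with
    | zero => simp [eberlein_zero_right]
    | succ k =>
      rw [eberlein, ih, ih]
      have split : ∀ s : ℕ, ((j + 1).choose s : ℤ) = (j.choose s : ℤ) +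
          (if s = 0 then 0 else (j.choose (s - 1) : ℤ)) := by
        intro s
        cases s with
        | zero => simp
        | succ s => simp [Nat.choose_succ_succ, add_comm]
      have hR : ∑ s ∈ Finset.range (k + 1 + 1), (-1 : ℤ) ^ s * ((j + 1).choose s : ℤ) *
            ((a + s).choose (k + 1) : ℤ) * ((b + (j + 1) - s).choose (k + 1 - s) : ℤ) =
          ∑ s ∈ Finset.range (k + 1 + 1), (-1 : ℤ) ^ s * (j.choose s : ℤ) *
            ((a + s).choose (k + 1) : ℤ) * ((b + (j + 1) - s).choose (k + 1 - s) : ℤ) -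
          ∑ s ∈ Finset.range (k + 1), (-1 : ℤ) ^ s * (j.choose s : ℤ) *
            ((a + (s + 1)).choose (k + 1) : ℤ) * ((b + j - s).choose (k - s) : ℤ) := by
        rw [sub_eq_add_neg, ← Finset.sum_neg_distrib]
        simp_rw [split, mul_add, add_mul]
        rw [Finset.sum_add_distrib]
        congr 1
        rw [Finset.sum_range_succ']
        simp only [if_true, mul_zero, zero_mul, add_zero]
        refine Finset.sum_congr rfl fun s _ => ?_
        rw [if_neg (Nat.succ_ne_zero s), show b + (j + 1) - (s + 1) = b + j - s by omega,
          show k + 1 - (s + 1) = k - s by omega, show s + 1 - 1 = s by omega]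
        ring
      have hP : ∑ s ∈ Finset.range (k + 1 + 1), (-1 : ℤ) ^ s * (j.choose s : ℤ) *
            ((a + s).choose (k + 1) : ℤ) * ((b + (j + 1) - s).choose (k + 1 - s) : ℤ) =
          ∑ s ∈ Finset.range (k + 1 + 1), (-1 : ℤ) ^ s * (j.choose s : ℤ) *
            ((a + s).choose (k + 1) : ℤ) * ((b + j - s).choose (k + 1 - s) : ℤ) +
          ∑ s ∈ Finset.range (k + 1), (-1 : ℤ) ^ s * (j.choose s : ℤ) *
            ((a + s).choose (k + 1) : ℤ) * ((b + j - s).choose (k - s) : ℤ) := by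
        rw [Finset.sum_range_succ, Finset.sum_range_succ (n := k + 1), add_right_comm,
          ← Finset.sum_add_distrib]
        congr 1
        · refine Finset.sum_congr rfl fun s hs => ?_
          rw [Finset.mem_range] at hs
          -- For `s > j` the difference `b + j - s` may be truncated, but `C(j, s) = 0` there.
          rcases le_or_gt s j with h | h
          · rw [show b + (j + 1) - s = b + j - s + 1 by omega,
              show k + 1 - s = k - s + 1 by omega, Nat.choose_succ_succ]
            push_cast
            ring
          · simp [Nat.choose_eq_zero_of_lt h]
        · simp
      rw [hR, hP, add_sub_assoc, sub_eq_add_neg, ← Finset.sum_sub_distrib,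
        ← Finset.sum_neg_distrib]
      congr 1
      refine Finset.sum_congr rfl fun s _ => ?_
      rw [← add_assoc a s 1, Nat.choose_succ_succ (a + s) k]
      push_cast
      ring

theorem eigFormula_eq_eberlein {n l j : ℕ} (k : ℕ) (hj : j ≤ min l (n - l)) :
    eigFormula n l k j = eberlein (l - j) (n - l - j) j k := by
  have h₂ : j ≤ n - l := hj.trans (min_le_right _ _)
  rw [eberlein_eq_sum, ← Finset.sum_flip, eigFormula]
  refine (Finset.sum_congr rfl fun r hr => ?_).trans
    (Finset.sum_subset (s₁ := Finset.Icc (k - j) (min k (l - j))) ?_ ?_)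
  · rw [Finset.mem_Icc, le_min_iff] at hr
    rw [show l - j + (k - r) = l - j + k - r by omega,
      show n - l - j + j - (k - r) = n - l + r - k by omega, show k - (k - r) = r by omega]
    ring
  · intro r hr
    rw [Finset.mem_Icc, le_min_iff] at hr
    exact Finset.mem_range.2 (by omega)
  · intro r hr hr'
    rw [Finset.mem_range] at hr
    rw [Finset.mem_Icc, le_min_iff] at hr'
    -- With `s = k - r`, the terms outside the range vanish: below it `C(j, k-r) = 0`, above it
    -- `C(l-j+k-r, k) = 0`.
    rcases lt_or_ge r (k - j) with h | h
    · simp [Nat.choose_eq_zero_of_lt (show j < k - r by omega)]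
    · simp [Nat.choose_eq_zero_of_lt (show l - j + (k - r) < k by omega)]

/-- Signed count of pairs of `k`-subsets of `O` and `Z`: the index `i` contributes `1` if neither
`o i` nor `z i` is chosen, `-1` if both are, and `0` otherwise. -/
theorem sum_powersetCard_prod_eq_eberlein {ι α : Type*} [DecidableEq α] {o z : ι → α}
    (ho : Function.Injective o) (hz : Function.Injective z) (S : Finset ι) (O Z : Finset α)
    (hO : ∀ i ∈ S, o i ∈ O) (hZ : ∀ i ∈ S, z i ∈ Z) (k : ℕ) :
    ∑ F ∈ O.powersetCard k, ∑ G ∈ Z.powersetCard k,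
      ∏ i ∈ S, ((1 : ℤ) - (if o i ∈ F then 1 else 0) - (if z i ∈ G then 1 else 0)) =
    eberlein (O.card - S.card) (Z.card - S.card) S.card k := by
  classical
  induction S using Finset.induction_on generalizing O Z k with
  | empty => simp [eberlein]
  | insert i S hi ih =>
    have hoi := hO i (Finset.mem_insert_self i S)
    have hzi := hZ i (Finset.mem_insert_self i S)
    have hO' : ∀ m ∈ S, o m ∈ O.erase (o i) := fun m hm =>
      Finset.mem_erase.2 ⟨fun h => hi ((ho h : m = i) ▸ hm), hO m (Finset.mem_insert_of_mem hm)⟩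
    have hZ' : ∀ m ∈ S, z m ∈ Z.erase (z i) := fun m hm =>
      Finset.mem_erase.2 ⟨fun h => hi ((hz h : m = i) ▸ hm), hZ m (Finset.mem_insert_of_mem hm)⟩
    -- Erasing one point lowers `O.card` and `Z.card` together with the number of pairs, so the
    -- parameters `a` and `b` stay fixed.
    have key := ih (O.erase (o i)) (Z.erase (z i)) hO' hZ'
    rw [Finset.card_erase_of_mem hoi, Finset.card_erase_of_mem hzi,
      Nat.sub_sub, Nat.sub_sub, add_comm 1] at key
    rw [Finset.card_insert_of_notMem hi]
    cases k with
    | zero =>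
      rw [eberlein, ← key 0]
      simp
    | succ k =>
      rw [eberlein, ← key (k + 1), ← key k]
      have hins : ∀ {x : α} {s : Finset α}, x ∉ s → ∀ f : Finset α → ℤ,
          ∑ F ∈ (insert x s).powersetCard (k + 1), f F =
          ∑ F ∈ s.powersetCard (k + 1), f F + ∑ F ∈ s.powersetCard k, f (insert x F) := by
        intro x s hx f
        have hnot : ∀ {m : ℕ} {F : Finset α}, F ∈ s.powersetCard m → x ∉ F := fun hF h =>
          hx ((Finset.mem_powersetCard.1 hF).1 h)
        rw [Finset.powersetCard_succ_insert hx, Finset.sum_union, Finset.sum_image]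
        · intro F hF G hG h
          rw [← Finset.erase_insert (hnot hF), h, Finset.erase_insert (hnot hG)]
        · rw [Finset.disjoint_left]
          intro F hF hF'
          obtain ⟨G, -, rfl⟩ := Finset.mem_image.1 hF'
          exact hnot hF (Finset.mem_insert_self x G)
      conv_lhs => rw [← Finset.insert_erase hoi, ← Finset.insert_erase hzi]
      rw [hins (Finset.notMem_erase _ _)]
      simp_rw [hins (Finset.notMem_erase (z i) Z), Finset.prod_insert hi]
      have memO : ∀ {m : ℕ} {F : Finset α}, F ∈ (O.erase (o i)).powersetCard m → o i ∉ F :=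
        fun hF h => Finset.notMem_erase _ _ ((Finset.mem_powersetCard.1 hF).1 h)
      have memZ : ∀ {m : ℕ} {F : Finset α}, F ∈ (Z.erase (z i)).powersetCard m → z i ∉ F :=
        fun hF h => Finset.notMem_erase _ _ ((Finset.mem_powersetCard.1 hF).1 h)
      have insO : ∀ {m : ι} (F : Finset α), m ∈ S → (o m ∈ insert (o i) F ↔ o m ∈ F) := by
        intro m F hm
        rw [Finset.mem_insert, or_iff_right fun h => hi ((ho h : m = i) ▸ hm)]
      have insZ : ∀ {m : ι} (F : Finset α), m ∈ S → (z m ∈ insert (z i) F ↔ z m ∈ F) := by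
        intro m F hm
        rw [Finset.mem_insert, or_iff_right fun h => hi ((hz h : m = i) ▸ hm)]
      -- The factor at `i` is 0 when exactly one of `o i`, `z i` is chosen. "Neither" leaves `k + 1`
      -- elements to choose on each side, "both" leaves `k` with sign -1: the recursion.
      rw [sub_eq_add_neg, ← Finset.sum_neg_distrib]
      congr 1
      · refine Finset.sum_congr rfl fun F hF => ?_
        rw [Finset.sum_congr rfl fun G hG => by
            rw [if_neg (memO hF), if_neg (memZ hG), sub_zero, sub_zero, one_mul],
          Finset.sum_congr (s₁ := (Z.erase (z i)).powersetCard k) rfl fun G hG => by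
            rw [if_neg (memO hF), if_pos (Finset.mem_insert_self _ _), sub_zero, sub_self,
              zero_mul]]
        simp
      · refine Finset.sum_congr rfl fun F hF => ?_
        rw [Finset.sum_congr rfl fun G hG => by
            rw [if_pos (Finset.mem_insert_self _ _), if_neg (memZ hG), sub_self, sub_zero,
              zero_mul],
          Finset.sum_congr (s₁ := (Z.erase (z i)).powersetCard k) rfl fun G hG => by
            rw [if_pos (Finset.mem_insert_self _ _), if_pos (Finset.mem_insert_self _ _),
              sub_self, zero_sub, neg_one_mul, Finset.prod_congr rfl fun m hm => by
                rw [if_congr (insO F hm) rfl rfl, if_congr (insZ G hm) rfl rfl]]]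
        simp

/-! ### Permutation operators and the distance operator -/

theorem permString_apply {n l : ℕ} (π : Equiv.Perm (Fin n)) (x : WeightString n l) (i : Fin n) :
    (permString π x).1 i = x.1 (π i) := rfl

theorem permOp_apply {n l : ℕ} (π : Equiv.Perm (Fin n)) (ψ : WeightSpace n l)
    (x : WeightString n l) : permOp π ψ x = ψ (permString π⁻¹ x) := rfl

/-- Permuting places is precomposition, so products are reversed. -/
theorem permOp_permOp {n l : ℕ} (π σ : Equiv.Perm (Fin n)) (ψ : WeightSpace n l) :
    permOp π (permOp σ ψ) = permOp (σ * π) ψ := rfl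

theorem permOp_one {n l : ℕ} (ψ : WeightSpace n l) : permOp 1 ψ = ψ := rfl

theorem inner_permOp_permOp {n l : ℕ} (π : Equiv.Perm (Fin n)) (φ ψ : WeightSpace n l) :
    inner ℂ (permOp π φ) (permOp π ψ) = inner ℂ φ ψ :=
  LinearIsometryEquiv.inner_map_map _ φ ψ

theorem distOp_apply {n l k : ℕ} (ψ : WeightSpace n l) (x : WeightString n l) :
    distOp n l k ψ x = ∑ y, if hammingDist x.1 y.1 = 2 * k then ψ y else 0 := by
  simp [distOp, Matrix.toLpLin_apply, Matrix.mulVec, dotProduct]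

theorem hammingDist_permString {n l : ℕ} (π : Equiv.Perm (Fin n)) (x y : WeightString n l) :
    hammingDist (permString π x).1 (permString π y).1 = hammingDist x.1 y.1 := by
  refine Finset.card_bij (fun i _ => π i) (fun i hi => ?_) (by simp)
    (fun b hb => ⟨π.symm b, ?_, by simp⟩)
  · exact Finset.mem_filter.2 ⟨Finset.mem_univ _, (Finset.mem_filter.1 hi).2⟩
  · refine Finset.mem_filter.2 ⟨Finset.mem_univ _, ?_⟩
    rw [permString_apply, permString_apply, π.apply_symm_apply]
    exact (Finset.mem_filter.1 hb).2

theorem distOp_permOp {n l k : ℕ} (π : Equiv.Perm (Fin n)) (ψ : WeightSpace n l) :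
    distOp n l k (permOp π ψ) = permOp π (distOp n l k ψ) := by
  ext x
  rw [permOp_apply, distOp_apply, distOp_apply,
    ← Equiv.sum_comp (permString π⁻¹) (fun y => if hammingDist _ y.1 = 2 * k then ψ y else 0)]
  simp_rw [hammingDist_permString, permOp_apply]

theorem distOp_isSymmetric (n l k : ℕ) : (distOp n l k).IsSymmetric := by
  rw [distOp, Matrix.isSymmetric_toEuclideanLin_iff]
  ext x y
  simp [Matrix.conjTranspose_apply, hammingDist_comm, apply_ite]

/-! ### Singlet vectors and their symmetries -/

/-- The tensor product of the singlets `|10⟩ - |01⟩` on the pairs of places `(p i, q i)` and the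
sum of all basis vectors on the other places. -/
noncomputable def pairVec {n l j : ℕ} (p q : Fin j → Fin n) : WeightSpace n l :=
  WithLp.toLp 2 fun x => ∏ i, (((x.1 (p i)).val : ℂ) - ((x.1 (q i)).val : ℂ))

theorem pairVec_apply {n l j : ℕ} (p q : Fin j → Fin n) (x : WeightString n l) :
    (pairVec p q : WeightSpace n l) x = ∏ i, (((x.1 (p i)).val : ℂ) - ((x.1 (q i)).val : ℂ)) :=
  rfl

theorem permOp_pairVec {n l j : ℕ} (π : Equiv.Perm (Fin n)) (p q : Fin j → Fin n) :
    permOp π (pairVec p q : WeightSpace n l) = pairVec (⇑π⁻¹ ∘ p) (⇑π⁻¹ ∘ q) := rfl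

/-- The vector `g` changes sign under the exchange of the two places of a pair `(p i, q i)`. -/
def PairAntisymm {n l j : ℕ} (p q : Fin j → Fin n) (g : WeightSpace n l) : Prop :=
  ∀ i, permOp (Equiv.swap (p i) (q i)) g = -g

/-- The vector `g` is invariant under the exchange of places outside the pairs `(p i, q i)`. -/
def SymmOff {n l j : ℕ} (p q : Fin j → Fin n) (g : WeightSpace n l) : Prop :=
  ∀ a b, a ∉ Set.range (Sum.elim p q) → b ∉ Set.range (Sum.elim p q) →
    permOp (Equiv.swap a b) g = g

theorem pairAntisymm_pairVec {n l j : ℕ} {p q : Fin j → Fin n}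
    (h : Function.Injective (Sum.elim p q)) :
    PairAntisymm p q (pairVec p q : WeightSpace n l) := by
  have hp : Function.Injective p := fun a b hab => Sum.inl_injective (@h (.inl a) (.inl b) hab)
  have hq : Function.Injective q := fun a b hab => Sum.inr_injective (@h (.inr a) (.inr b) hab)
  have hpq : ∀ a b, p a ≠ q b := fun a b hab => Sum.inl_ne_inr (@h (.inl a) (.inr b) hab)
  intro i
  rw [permOp_pairVec]
  ext x
  rw [PiLp.neg_apply, pairVec_apply, pairVec_apply, ← Finset.mul_prod_erase _ _ (Finset.mem_univ i),
    ← Finset.mul_prod_erase Finset.univ (fun i => ((x.1 (p i)).val : ℂ) - ((x.1 (q i)).val : ℂ))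
      (Finset.mem_univ i), ← neg_mul, neg_sub]
  congr 1
  · simp
  · refine Finset.prod_congr rfl fun m hm => ?_
    have hm : m ≠ i := Finset.ne_of_mem_erase hm
    simp [Equiv.swap_apply_of_ne_of_ne, hp.ne hm, hq.ne hm, hpq, (hpq _ _).symm]

theorem symmOff_pairVec {n l j : ℕ} (p q : Fin j → Fin n) :
    SymmOff p q (pairVec p q : WeightSpace n l) := by
  intro a b ha hb
  rw [permOp_pairVec]
  ext x
  simp only [Set.mem_range, Sum.exists, Sum.elim_inl, Sum.elim_inr, not_or, not_exists] at ha hb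
  simp [pairVec_apply, Equiv.swap_apply_of_ne_of_ne, ha, hb]

/-! ### Uniqueness of a vector with the symmetries of `pairVec` -/

theorem hammingDist_swap_lt {n l : ℕ} {x y : WeightString n l} {a b : Fin n}
    (hab : x.1 a ≠ x.1 b) (ha : x.1 a ≠ y.1 a) (hb : x.1 b ≠ y.1 b) :
    hammingDist (permString (Equiv.swap a b) x).1 y.1 < hammingDist x.1 y.1 := by
  refine Finset.card_lt_card (Finset.ssubset_iff_of_subset ?_ |>.2 ⟨a, by simpa using ha, ?_⟩)
  · intro i hi
    have hi := (Finset.mem_filter.1 hi).2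
    refine Finset.mem_filter.2 ⟨Finset.mem_univ _, ?_⟩
    by_cases hia : i = a
    · exact hia ▸ ha
    by_cases hib : i = b
    · exact hib ▸ hb
    rwa [permString_apply, Equiv.swap_apply_of_ne_of_ne hia hib] at hi
  · intro h
    have h := (Finset.mem_filter.1 h).2
    rw [permString_apply, Equiv.swap_apply_left] at h
    have h : x.1 b ≠ y.1 a := h
    omega

/-- Otherwise all differences go in one direction, and the support of one string lies strictly
inside that of the other, contrary to equal weights. -/
theorem exists_opposite_difference {n l : ℕ} {x y : WeightString n l} {a : Fin n}
    (ha : x.1 a ≠ y.1 a) : ∃ b, x.1 b ≠ y.1 b ∧ x.1 a ≠ x.1 b := by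
  by_contra! hcon
  have key : ∀ z w : WeightString n l, z.1 a ≠ 0 → w.1 a = 0 →
      (∀ b, w.1 b ≠ 0 → z.1 b ≠ 0) → False := by
    intro z w hz hw hzw
    have hlt : hammingNorm w.1 < hammingNorm z.1 := by
      unfold hammingNorm
      refine Finset.card_lt_card (Finset.ssubset_iff_of_subset ?_ |>.2
        ⟨a, by simpa using hz, by simpa using hw⟩)
      intro i hi
      simp only [Finset.mem_filter, Finset.mem_univ, true_and] at hi ⊢
      exact hzw i hi
    rw [z.2, w.2] at hlt
    exact lt_irrefl _ hlt
  by_cases hx : x.1 a = 0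
  · refine key y x (by omega) hx fun b hb hb' => ?_
    have := hcon b (by omega)
    omega
  · refine key x y hx (by omega) fun b hb hb' => ?_
    have := hcon b (by omega)
    omega

theorem apply_eq_zero_of_pairAntisymm {n l j : ℕ} {p q : Fin j → Fin n} {g : WeightSpace n l}
    (hg : PairAntisymm p q g) {x : WeightString n l} {i : Fin j} (hx : x.1 (p i) = x.1 (q i)) :
    g x = 0 := by
  have h := congrArg (fun v : WeightSpace n l => v x) (hg i)
  have hfix : permString (Equiv.swap (p i) (q i)) x = x := by
    ext m
    simp only [permString, Equiv.coe_fn_mk]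
    rcases eq_or_ne m (p i) with rfl | hm
    · simp [hx]
    rcases eq_or_ne m (q i) with rfl | hm'
    · simp [hx]
    rw [Equiv.swap_apply_of_ne_of_ne hm hm']
  simp only [permOp_apply, Equiv.swap_inv, hfix, PiLp.neg_apply] at h
  exact self_eq_neg.1 h

/-- The symmetries of `pairVec p q` determine a vector up to a scalar. -/
theorem apply_mul_apply_comm {n l j : ℕ} {p q : Fin j → Fin n} {g h : WeightSpace n l}
    (hg : PairAntisymm p q g) (hg' : SymmOff p q g) (hh : PairAntisymm p q h)
    (hh' : SymmOff p q h) (x y : WeightString n l) : h x * g y = h y * g x := by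
  -- Allowed swaps move `x` towards `y`; each multiplies `g x` and `h x` by the same sign, so the
  -- identity is inherited from a closer string.
  induction hd : hammingDist x.1 y.1 using Nat.strong_induction_on generalizing x with
  | _ d ih =>
    subst hd
    by_cases hx : ∃ i, x.1 (p i) = x.1 (q i)
    · obtain ⟨i, hi⟩ := hx
      rw [apply_eq_zero_of_pairAntisymm hg hi, apply_eq_zero_of_pairAntisymm hh hi]
      simp
    by_cases hy : ∃ i, y.1 (p i) = y.1 (q i)
    · obtain ⟨i, hi⟩ := hy
      rw [apply_eq_zero_of_pairAntisymm hg hi, apply_eq_zero_of_pairAntisymm hh hi]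
      simp
    push Not at hx hy
    by_cases hxy : ∃ i, x.1 (p i) ≠ y.1 (p i)
    · obtain ⟨i, hi⟩ := hxy
      have h₁ := hx i
      have h₂ := hy i
      have key : ∀ {f : WeightSpace n l}, PairAntisymm p q f →
          f (permString (Equiv.swap (p i) (q i)) x) = -f x := fun {f} hf => by
        rw [← PiLp.neg_apply, ← hf i, permOp_apply, Equiv.swap_inv]
      have hlt := hammingDist_swap_lt h₁ hi (show x.1 (q i) ≠ y.1 (q i) by omega)
      have hres := ih _ hlt (permString (Equiv.swap (p i) (q i)) x) rfl
      rw [key hg, key hh, mul_neg, neg_mul, neg_inj] at hres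
      exact hres
    -- Now `x` and `y` agree on the first place of every pair; both take opposite values within each
    -- pair, so they agree on the second places too and differ only off the pairs.
    · push Not at hxy
      by_cases hne : x = y
      · rw [hne]
      obtain ⟨a, ha⟩ : ∃ a, x.1 a ≠ y.1 a := by
        by_contra! h
        exact hne (Subtype.ext (funext h))
      obtain ⟨b, hb, hab⟩ := exists_opposite_difference ha
      have off : ∀ c, x.1 c ≠ y.1 c → c ∉ Set.range (Sum.elim p q) := by
        rintro c hc ⟨i | i, rfl⟩
        · exact hc (hxy i)
        · have := hx i
          have := hy i
          have := hxy i
          simp only [Sum.elim_inr] at hc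
          omega
      have key : ∀ {f : WeightSpace n l}, SymmOff p q f →
          f (permString (Equiv.swap a b) x) = f x := fun {f} hf => by
        conv_rhs => rw [← hf a b (off a ha) (off b hb), permOp_apply, Equiv.swap_inv]
      have hres := ih _ (hammingDist_swap_lt hab ha hb) (permString (Equiv.swap a b) x) rfl
      rwa [key hg', key hh'] at hres

/-! ### The Young symmetrizer of the standard tableau -/

/-- The first `j` entries of the first row of the standard tableau of shape `(n - j, j)`. -/
def topEntry {n j : ℕ} (h : 2 * j ≤ n) (i : Fin j) : Fin n := ⟨i, by omega⟩

/-- The entries of the second row of the standard tableau of shape `(n - j, j)`. -/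
def bottomEntry {n j : ℕ} (h : 2 * j ≤ n) (i : Fin j) : Fin n := ⟨n - j + i, by omega⟩

theorem entries_injective {n j : ℕ} (h : 2 * j ≤ n) :
    Function.Injective (Sum.elim (topEntry h) (bottomEntry h)) := by
  rintro (a | a) (b | b) hab <;> simp [topEntry, bottomEntry] at hab ⊢ <;> omega

theorem notMem_range_entries {n j : ℕ} (h : 2 * j ≤ n) {a : Fin n}
    (ha : a ∉ Set.range (Sum.elim (topEntry h) (bottomEntry h))) : j ≤ a ∧ (a : ℕ) < n - j := by
  by_contra hcon
  refine ha ?_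
  by_cases h' : (a : ℕ) < j
  · exact ⟨.inl ⟨a, h'⟩, rfl⟩
  · refine ⟨.inr ⟨a - (n - j), by omega⟩, Fin.ext ?_⟩
    simp only [Sum.elim_inr, bottomEntry]
    omega

theorem permOp_rowSymmetrizer {n l j : ℕ} {ρ : Equiv.Perm (Fin n)}
    (hρ : ∀ i, tableauRow n j (ρ i) = tableauRow n j i) (ψ : WeightSpace n l) :
    permOp ρ (rowSymmetrizer n l j ψ) = rowSymmetrizer n l j ψ := by
  simp only [rowSymmetrizer, LinearMap.sum_apply, map_sum, permOp_permOp]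
  refine Finset.sum_equiv (Equiv.mulRight ρ) (fun π => ?_) fun π _ => rfl
  simp only [Finset.mem_filter, Finset.mem_univ, true_and, Equiv.coe_mulRight, Equiv.Perm.mul_apply]
  refine ⟨fun h i => (h _).trans (hρ i), fun h i => ?_⟩
  have h₁ := h (ρ.symm i)
  have h₂ := hρ (ρ.symm i)
  rw [Equiv.apply_symm_apply] at h₁ h₂
  exact h₁.trans h₂.symm

theorem permOp_colAntisymmetrizer {n l j : ℕ} {τ : Equiv.Perm (Fin n)}
    (hτ : ∀ i, tableauCol n j (τ i) = tableauCol n j i) (ψ : WeightSpace n l) :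
    permOp τ (colAntisymmetrizer n l j ψ) =
      ((Equiv.Perm.sign τ : ℤ) : ℂ) • colAntisymmetrizer n l j ψ := by
  simp only [colAntisymmetrizer, LinearMap.sum_apply, map_sum, LinearMap.smul_apply, map_smul,
    permOp_permOp, Finset.smul_sum, smul_smul]
  refine Finset.sum_equiv (Equiv.mulRight τ) (fun π => ?_) fun π _ => ?_
  · simp only [Finset.mem_filter, Finset.mem_univ, true_and, Equiv.coe_mulRight,
      Equiv.Perm.mul_apply]
    refine ⟨fun h i => (h _).trans (hτ i), fun h i => ?_⟩
    have h₁ := h (τ.symm i)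
    have h₂ := hτ (τ.symm i)
    rw [Equiv.apply_symm_apply] at h₁ h₂
    exact h₁.trans h₂.symm
  · rw [Equiv.coe_mulRight]
    congr 1
    have hs : ((Equiv.Perm.sign τ : ℤ) : ℂ) * ((Equiv.Perm.sign τ : ℤ) : ℂ) = 1 := by
      rcases Int.units_eq_one_or (Equiv.Perm.sign τ) with h | h <;> simp [h]
    rw [Equiv.Perm.sign_mul, Units.val_mul, Int.cast_mul, mul_left_comm, hs, mul_one]

theorem pairAntisymm_colAntisymmetrizer {n l j : ℕ} (h : 2 * j ≤ n) (ψ : WeightSpace n l) :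
    PairAntisymm (topEntry h) (bottomEntry h) (colAntisymmetrizer n l j ψ) := by
  intro i
  have hne : topEntry h i ≠ bottomEntry h i := fun hcon =>
    Sum.inl_ne_inr (@entries_injective n j h (.inl i) (.inr i) hcon)
  have hcol : tableauCol n j (topEntry h i) = tableauCol n j (bottomEntry h i) := by
    have := i.2
    rw [tableauCol, tableauCol, if_pos (by dsimp only [topEntry]; omega),
      if_neg (by dsimp only [bottomEntry]; omega)]
    dsimp only [topEntry, bottomEntry]
    omega
  rw [permOp_colAntisymmetrizer, Equiv.Perm.sign_swap hne]
  · simp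
  · intro m
    rcases eq_or_ne m (topEntry h i) with rfl | hm
    · rw [Equiv.swap_apply_left, hcol]
    rcases eq_or_ne m (bottomEntry h i) with rfl | hm'
    · rw [Equiv.swap_apply_right, hcol]
    rw [Equiv.swap_apply_of_ne_of_ne hm hm']

theorem apply_eq_self_of_tableauCol {n j : ℕ} {π : Equiv.Perm (Fin n)}
    (hπ : ∀ i, tableauCol n j (π i) = tableauCol n j i) {a : Fin n} (ha : j ≤ (a : ℕ))
    (ha' : (a : ℕ) < n - j) : π a = a := by
  have h := hπ a
  have := (π a).2
  simp only [tableauCol, if_pos ha'] at h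
  split_ifs at h with h'
  · exact Fin.ext h
  · omega

/-- Places off the pairs form columns of length one, fixed by every column permutation. A swap of
two of them therefore commutes with the column antisymmetrizer and is absorbed by the row
symmetrizer. -/
theorem symmOff_colAntisymmetrizer_rowSymmetrizer {n l j : ℕ} (h : 2 * j ≤ n)
    (ψ : WeightSpace n l) : SymmOff (topEntry h) (bottomEntry h)
      (colAntisymmetrizer n l j (rowSymmetrizer n l j ψ)) := by
  intro a b ha hb
  obtain ⟨ha₁, ha₂⟩ := notMem_range_entries h ha
  obtain ⟨hb₁, hb₂⟩ := notMem_range_entries h hb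
  have hrow : permOp (Equiv.swap a b) (rowSymmetrizer n l j ψ) = rowSymmetrizer n l j ψ := by
    refine permOp_rowSymmetrizer (fun m => ?_) ψ
    rcases eq_or_ne m a with rfl | hm
    · rw [Equiv.swap_apply_left, tableauRow, tableauRow, if_pos ha₂, if_pos hb₂]
    rcases eq_or_ne m b with rfl | hm'
    · rw [Equiv.swap_apply_right, tableauRow, tableauRow, if_pos ha₂, if_pos hb₂]
    rw [Equiv.swap_apply_of_ne_of_ne hm hm']
  simp only [colAntisymmetrizer, LinearMap.sum_apply, map_sum, LinearMap.smul_apply, map_smul]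
  refine Finset.sum_congr rfl fun π hπ => ?_
  have hπ := (Finset.mem_filter.1 hπ).2
  conv_rhs => rw [← hrow, permOp_permOp]
  rw [permOp_permOp, Equiv.mul_swap_eq_swap_mul, apply_eq_self_of_tableauCol hπ ha₁ ha₂,
    apply_eq_self_of_tableauCol hπ hb₁ hb₂]

/-- The string `1…10…0` with `l` ones. -/
def frontString {n l : ℕ} (hl : l ≤ n) : WeightString n l :=
  ⟨fun i => if (i : ℕ) < l then 1 else 0, by simp [hammingNorm, Fin.card_filter_val_lt, hl]⟩

theorem frontString_apply {n l : ℕ} (hl : l ≤ n) (i : Fin n) :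
    (frontString hl).1 i = if (i : ℕ) < l then 1 else 0 := rfl

theorem pairVec_frontString {n l j : ℕ} (hl : l ≤ n) (hj : j ≤ min l (n - l)) (h : 2 * j ≤ n) :
    (pairVec (topEntry h) (bottomEntry h) : WeightSpace n l) (frontString hl) = 1 := by
  rw [pairVec_apply]
  refine Finset.prod_eq_one fun i _ => ?_
  have := i.2
  rw [frontString_apply, frontString_apply, topEntry, bottomEntry, if_pos (by dsimp; omega),
    if_neg (by dsimp; omega)]
  simp

theorem colAntisymmetrizer_rowSymmetrizer_frontString_ne_zero {n l j : ℕ} (hl : l ≤ n)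
    (hj : j ≤ min l (n - l)) :
    colAntisymmetrizer n l j (rowSymmetrizer n l j
      (EuclideanSpace.single (frontString hl) 1)) (frontString hl) ≠ 0 := by
  classical
  have hw : ∀ y : WeightString n l, rowSymmetrizer n l j
      (EuclideanSpace.single (frontString hl) 1) y =
      ((Finset.univ.filter fun ρ : Equiv.Perm (Fin n) =>
        (∀ i, tableauRow n j (ρ i) = tableauRow n j i) ∧
          y = permString ρ (frontString hl)).card : ℂ) := by
    intro y
    simp only [rowSymmetrizer, LinearMap.sum_apply, permOp_single, WithLp.ofLp_sum,
      Finset.sum_apply, PiLp.single_apply]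
    rw [Finset.sum_boole, Finset.filter_filter]
  have hA : colAntisymmetrizer n l j (rowSymmetrizer n l j
      (EuclideanSpace.single (frontString hl) 1)) (frontString hl) =
      rowSymmetrizer n l j (EuclideanSpace.single (frontString hl) 1) (frontString hl) := by
    simp only [colAntisymmetrizer, LinearMap.sum_apply, LinearMap.smul_apply, WithLp.ofLp_sum,
      Finset.sum_apply, PiLp.smul_apply]
    -- Only `π = 1` contributes, so the value is a positive count of row permutations and no
    -- cancellation occurs.
    rw [Finset.sum_eq_single_of_mem 1 (by simp)]
    · simp [permOp_one]
    · intro π hπ hne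
      have hπ := (Finset.mem_filter.1 hπ).2
      rw [permOp_apply, hw, Finset.card_eq_zero.2, Nat.cast_zero, smul_zero]
      refine Finset.filter_eq_empty_iff.2 ?_
      rintro ρ - ⟨hρ, heq⟩
      refine hne ?_
      -- `ρ m` stays in the second row, where the front string is 0 since `l ≤ n - j`. The top of
      -- the column of `m` has index below `j ≤ l` and carries a 1, so `π.symm` cannot send `m`
      -- there.
      have hzero : ∀ m : Fin n, n - j ≤ (m : ℕ) → π.symm m = m := by
        intro m hm
        have h₁ : (frontString hl).1 (π.symm m) = (frontString hl).1 (ρ m) :=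
          congrArg (fun x : WeightString n l => x.1 m) heq
        have h₂ := hρ m
        have h₃ := hπ (π.symm m)
        rw [Equiv.apply_symm_apply] at h₃
        have := (π.symm m).2
        have := (ρ m).2
        simp only [frontString_apply, tableauRow, tableauCol] at h₁ h₂ h₃
        ext
        split_ifs at h₁ h₂ h₃ <;> omega
      ext m
      by_cases hm : (m : ℕ) < n - j
      · have h₃ := hπ m
        have hlt : ((π m : Fin n) : ℕ) < n - j := by
          by_contra hcon
          have := hzero (π m) (by omega)
          rw [Equiv.symm_apply_apply] at this
          rw [← this] at hcon
          exact hcon hm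
        simpa [tableauCol, hm, hlt] using h₃
      · rw [← hzero m (by omega), Equiv.apply_symm_apply, hzero m (by omega)]
        rfl
  rw [hA, hw, Nat.cast_ne_zero, Finset.card_ne_zero]
  exact ⟨1, Finset.mem_filter.2 ⟨Finset.mem_univ _, fun _ => rfl, rfl⟩⟩

theorem eq_smul_pairVec {n l j : ℕ} (hl : l ≤ n) (hj : j ≤ min l (n - l)) (h : 2 * j ≤ n)
    {g : WeightSpace n l} (hg : PairAntisymm (topEntry h) (bottomEntry h) g)
    (hg' : SymmOff (topEntry h) (bottomEntry h) g) :
    g = g (frontString hl) • pairVec (topEntry h) (bottomEntry h) := by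
  ext x
  have hx := apply_mul_apply_comm hg hg' (pairAntisymm_pairVec (entries_injective h))
    (symmOff_pairVec _ _) (frontString hl) x
  rw [pairVec_frontString hl hj, one_mul] at hx
  rw [hx, PiLp.smul_apply, smul_eq_mul, mul_comm]

theorem irrepDim_div_factorial_ne_zero {n j : ℕ} (h : 2 * j ≤ n) :
    irrepDim n j / (n.factorial : ℂ) ≠ 0 := by
  have h₁ : (n.choose j : ℂ) ≠ 0 := Nat.cast_ne_zero.2 (Nat.choose_pos (by omega)).ne'
  have h₂ : (n : ℂ) - 2 * j + 1 ≠ 0 := by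
    rw [show (n : ℂ) - 2 * j + 1 = ((n - 2 * j + 1 : ℕ) : ℂ) by push_cast [Nat.cast_sub h]; ring]
    exact Nat.cast_ne_zero.2 (by omega)
  have h₃ : (n : ℂ) - j + 1 ≠ 0 := by
    rw [show (n : ℂ) - j + 1 = ((n - j + 1 : ℕ) : ℂ) by
      push_cast [Nat.cast_sub (show j ≤ n by omega)]; ring]
    exact Nat.cast_ne_zero.2 (by omega)
  exact div_ne_zero (div_ne_zero (mul_ne_zero h₁ h₂) h₃)
    (Nat.cast_ne_zero.2 n.factorial_ne_zero)

/-- The part `B_j` is generated by the vector `pairVec` of the standard tableau. -/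
theorem irrepPart_eq_span {n l j : ℕ} (hl : l ≤ n) (hj : j ≤ min l (n - l)) (h : 2 * j ≤ n) :
    irrepPart n l j = Submodule.span ℂ (Set.range fun π : Equiv.Perm (Fin n) =>
      permOp π (pairVec (topEntry h) (bottomEntry h) : WeightSpace n l)) := by
  have hy : ∀ ψ : WeightSpace n l, youngSymmetrizer n l j ψ =
      (irrepDim n j / (n.factorial : ℂ) *
        colAntisymmetrizer n l j (rowSymmetrizer n l j ψ) (frontString hl)) •
          pairVec (topEntry h) (bottomEntry h) := by
    intro ψ
    rw [youngSymmetrizer, LinearMap.smul_apply, LinearMap.comp_apply, mul_smul,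
      ← eq_smul_pairVec hl hj h (pairAntisymm_colAntisymmetrizer h _)
        (symmOff_colAntisymmetrizer_rowSymmetrizer h ψ)]
  apply le_antisymm
  · rw [irrepPart, Submodule.span_le]
    rintro _ ⟨π, ψ, rfl⟩
    rw [hy, map_smul]
    exact Submodule.smul_mem _ _ (Submodule.subset_span ⟨π, rfl⟩)
  · rw [Submodule.span_le]
    rintro _ ⟨π, rfl⟩
    -- The front string is a test vector whose image is a nonzero multiple of `pairVec`, which can
    -- thus be recovered.
    have hc := mul_ne_zero (irrepDim_div_factorial_ne_zero h)
      (colAntisymmetrizer_rowSymmetrizer_frontString_ne_zero hl hj)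
    have hv : permOp π (pairVec (topEntry h) (bottomEntry h) : WeightSpace n l) =
        (irrepDim n j / (n.factorial : ℂ) * colAntisymmetrizer n l j (rowSymmetrizer n l j
          (EuclideanSpace.single (frontString hl) 1)) (frontString hl))⁻¹ •
        permOp π (youngSymmetrizer n l j (EuclideanSpace.single (frontString hl) 1)) := by
      rw [hy, map_smul, inv_smul_smul₀ hc]
    rw [SetLike.mem_coe]
    beta_reduce
    rw [hv]
    exact Submodule.smul_mem _ _ (Submodule.subset_span ⟨π, _, rfl⟩)

/-- Any `j` disjoint pairs are carried to the standard ones by a permutation. -/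
theorem pairVec_mem_irrepPart {n l j : ℕ} (hl : l ≤ n) (hj : j ≤ min l (n - l))
    {p q : Fin j → Fin n} (hpq : Function.Injective (Sum.elim p q)) :
    (pairVec p q : WeightSpace n l) ∈ irrepPart n l j := by
  have h : 2 * j ≤ n := by omega
  obtain ⟨σ, hσ⟩ := Equiv.Perm.exists_extending_pair _ _ (entries_injective h) hpq
  have : (pairVec p q : WeightSpace n l) = permOp σ⁻¹ (pairVec (topEntry h) (bottomEntry h)) := by
    rw [permOp_pairVec, inv_inv]
    congr 1
    · exact funext fun i => (hσ (.inl i)).symm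
    · exact funext fun i => (hσ (.inr i)).symm
  rw [this, irrepPart_eq_span hl hj h]
  exact Submodule.subset_span ⟨_, rfl⟩

theorem irrepPart_ne_bot {n l j : ℕ} (hl : l ≤ n) (hj : j ≤ min l (n - l)) :
    irrepPart n l j ≠ ⊥ := by
  have h : 2 * j ≤ n := by omega
  intro hbot
  have hv := pairVec_mem_irrepPart hl hj (entries_injective h)
  rw [hbot, Submodule.mem_bot] at hv
  have h1 := pairVec_frontString hl hj h
  rw [hv] at h1
  exact zero_ne_one h1

theorem permOp_mem_irrepPart {n l j : ℕ} (π : Equiv.Perm (Fin n)) {ψ : WeightSpace n l}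
    (hψ : ψ ∈ irrepPart n l j) : permOp π ψ ∈ irrepPart n l j := by
  have : irrepPart n l j ≤ (irrepPart n l j).comap (permOp π) := by
    conv_lhs => rw [irrepPart]
    rw [Submodule.span_le]
    rintro _ ⟨σ, φ, rfl⟩
    exact Submodule.subset_span ⟨σ * π, φ, rfl⟩
  exact this hψ

/-! ### Completeness of the parts `B_j` -/

/-- A string with nonzero coefficient has a one and a zero in each of the `j` disjoint pairs,
forcing `j ≤ l` and `j ≤ n - l`. -/
theorem pairVec_eq_zero {n l j : ℕ} (hj : ¬ j ≤ min l (n - l)) {p q : Fin j → Fin n}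
    (hpq : Function.Injective (Sum.elim p q)) : (pairVec p q : WeightSpace n l) = 0 := by
  ext x
  by_contra hx
  refine hj ?_
  have hne : ∀ i, x.1 (p i) ≠ x.1 (q i) := fun i hi => hx <| by
    rw [pairVec_apply]
    exact Finset.prod_eq_zero (Finset.mem_univ i) (by rw [hi, sub_self])
  have hcard : (Finset.univ.filter fun i => x.1 i ≠ 0).card = l := x.2
  have hcard' : (Finset.univ.filter fun i => ¬ x.1 i ≠ 0).card = n - l := by
    have := Finset.card_filter_add_card_filter_not (s := (Finset.univ : Finset (Fin n)))
      (fun i => x.1 i ≠ 0)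
    rw [hcard, Finset.card_univ, Fintype.card_fin] at this
    omega
  have key : ∀ P : Fin n → Prop, [DecidablePred P] → (∀ i, P (p i) ∨ P (q i)) →
      j ≤ (Finset.univ.filter P).card := by
    intro P _ hP
    have hsel : ∀ i, ∃ m : Fin j ⊕ Fin j, P (Sum.elim p q m) ∧ Sum.elim id id m = i := by
      intro i
      rcases hP i with h | h
      · exact ⟨.inl i, h, rfl⟩
      · exact ⟨.inr i, h, rfl⟩
    choose m hm hmi using hsel
    have := Finset.card_le_card_of_injOn (s := (Finset.univ : Finset (Fin j)))
      (t := Finset.univ.filter P) (fun i => Sum.elim p q (m i)) (fun i _ => by simpa using hm i)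
      (fun a _ b _ hab => by rw [← hmi a, ← hmi b, hpq hab])
    simpa using this
  refine le_min (hcard ▸ key _ fun i => ?_) (hcard' ▸ key _ fun i => ?_)
  · have := hne i
    omega
  · have := hne i
    omega

/-- A vector orthogonal to all parts `B_i` that changes sign under the exchange of each of `j`
disjoint pairs vanishes. The proof is a downward induction on `j`. -/
theorem PairAntisymm.eq_zero_of_orthogonal {n l : ℕ} (hl : l ≤ n) (d : ℕ) :
    ∀ {j : ℕ} (p q : Fin j → Fin n), n < j + d → Function.Injective (Sum.elim p q) →
      ∀ g : WeightSpace n l, PairAntisymm p q g →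
        (∀ i ≤ min l (n - l), ∀ w ∈ irrepPart n l i, inner ℂ w g = 0) → g = 0 := by
  induction d with
  | zero =>
    intro j p q hd hpq
    have := Fintype.card_le_of_injective _ hpq
    simp only [Fintype.card_sum, Fintype.card_fin] at this
    omega
  | succ d ih =>
    intro j p q hd hpq g hg horth
    -- For `a`, `b` off the pairs, `g - V g` with `V` their swap is odd in the extra pair `(a, b)`
    -- and still orthogonal to every `B_i`, so it vanishes by induction.
    have hsymm : SymmOff p q g := by
      intro a b ha hb
      rcases eq_or_ne a b with rfl | hab
      · rw [Equiv.swap_self]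
        rfl
      rw [← sub_eq_zero]
      refine ih (Fin.cons a p : Fin (j + 1) → Fin n) (Fin.cons b q) (by omega) ?_ _ ?_ ?_
      · simp only [Set.mem_range, Sum.exists, Sum.elim_inl, Sum.elim_inr, not_or,
          not_exists] at ha hb
        have hp : Function.Injective p := hpq.comp Sum.inl_injective
        have hq : Function.Injective q := hpq.comp Sum.inr_injective
        have hpq' : ∀ a b, p a ≠ q b := fun a b hab =>
          Sum.inl_ne_inr (@hpq (.inl a) (.inr b) hab)
        refine Function.Injective.sumElim
          (Fin.cons_injective_iff.2 ⟨fun ⟨i, hi⟩ => ha.1 i hi, hp⟩)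
          (Fin.cons_injective_iff.2 ⟨fun ⟨i, hi⟩ => hb.2 i hi, hq⟩) fun s t => ?_
        refine Fin.cases ?_ (fun s => ?_) s <;> refine Fin.cases ?_ (fun t => ?_) t
        · simpa using hab
        · simpa using fun h => ha.2 t h.symm
        · simpa using hb.1 s
        · simpa using hpq' s t
      · intro i
        refine Fin.cases ?_ (fun i => ?_) i
        · simp only [Fin.cons_zero, map_sub, permOp_permOp, Equiv.swap_mul_self, permOp_one,
            neg_sub]
        · have hdisj : Equiv.swap a b * Equiv.swap (p i) (q i) =
              Equiv.swap (p i) (q i) * Equiv.swap a b := by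
            have h₁ : ∀ c, c ∉ Set.range (Sum.elim p q) → Equiv.swap (p i) (q i) c = c :=
              fun c hc => Equiv.swap_apply_of_ne_of_ne (fun h => hc ⟨.inl i, h.symm⟩)
                (fun h => hc ⟨.inr i, h.symm⟩)
            rw [Equiv.mul_swap_eq_swap_mul (Equiv.swap (p i) (q i)) a b, h₁ a ha, h₁ b hb]
          rw [Fin.cons_succ, Fin.cons_succ, map_sub, hg i, permOp_permOp, hdisj,
            ← permOp_permOp, hg i, map_neg]
          abel
      · intro i hi w hw
        rw [inner_sub_right, horth i hi w hw, sub_zero]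
        have := inner_permOp_permOp (Equiv.swap a b) (permOp (Equiv.swap a b) w) g
        rw [permOp_permOp, Equiv.swap_mul_self, permOp_one] at this
        rw [this]
        exact horth i hi _ (permOp_mem_irrepPart _ hw)
    by_contra hne
    obtain ⟨x, hx⟩ : ∃ x, g x ≠ 0 := by
      by_contra! hcon
      exact hne (PiLp.ext hcon)
    have hvx : (pairVec p q : WeightSpace n l) x ≠ 0 := by
      rw [pairVec_apply]
      refine Finset.prod_ne_zero_iff.2 fun i _ => ?_
      rw [sub_ne_zero, Ne, Nat.cast_inj, ← Fin.ext_iff]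
      exact fun hi => hx (apply_eq_zero_of_pairAntisymm hg hi)
    -- By uniqueness `pairVec` is a nonzero multiple of `g`. It lies in `B_j`, or is 0 when `j` is
    -- too large; either way there is a contradiction.
    have hv : (pairVec p q : WeightSpace n l) = (pairVec p q x / g x) • g := by
      ext y
      have := apply_mul_apply_comm hg hsymm (pairAntisymm_pairVec hpq) (symmOff_pairVec p q) x y
      rw [PiLp.smul_apply, smul_eq_mul, div_mul_eq_mul_div, this, mul_div_cancel_right₀ _ hx]
    by_cases hj : j ≤ min l (n - l)
    · have h := horth j hj _ (pairVec_mem_irrepPart hl hj hpq)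
      rw [hv, inner_smul_left, mul_eq_zero, inner_self_eq_zero, map_eq_zero] at h
      exact h.elim (div_ne_zero hvx hx) hne
    · rw [pairVec_eq_zero hj hpq] at hvx
      exact hvx rfl

theorem eq_zero_of_orthogonal_irrepPart {n l : ℕ} (hl : l ≤ n) {g : WeightSpace n l}
    (hg : ∀ i ≤ min l (n - l), ∀ w ∈ irrepPart n l i, inner ℂ w g = 0) : g = 0 :=
  PairAntisymm.eq_zero_of_orthogonal hl (n + 1) (j := 0) Fin.elim0 Fin.elim0 (by omega)
    (fun a => by rcases a with a | a <;> exact a.elim0) g (fun i => i.elim0) hg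

theorem iSup_irrepPart {n l : ℕ} (hl : l ≤ n) :
    (⨆ j ∈ Finset.range (min l (n - l) + 1), irrepPart n l j) = ⊤ := by
  rw [← Submodule.orthogonal_eq_bot_iff, Submodule.eq_bot_iff]
  intro g hg
  refine eq_zero_of_orthogonal_irrepPart hl fun i hi w hw => ?_
  refine (Submodule.mem_orthogonal _ g).1 hg w ?_
  exact (le_iSup₂_of_le (f := fun j (_ : j ∈ Finset.range (min l (n - l) + 1)) =>
    irrepPart n l j) i (Finset.mem_range.2 (by omega)) le_rfl) hw

/-! ### The eigenvalue on `B_j` -/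

/-- A string at distance `2k` from `1…10…0` arises by deleting a `k`-set `F` of ones and adding a
`k`-set `G` of ones; the singlet factor on a pair is then 1, minus 1 if its top is in `F`, minus 1
if its bottom is in `G`. -/
theorem distOp_pairVec_frontString {n l j : ℕ} (k : ℕ) (hl : l ≤ n) (hj : j ≤ min l (n - l))
    (h : 2 * j ≤ n) :
    distOp n l k (pairVec (topEntry h) (bottomEntry h)) (frontString hl) =
      (eberlein (l - j) (n - l - j) j k : ℂ) := by
  have htop : Function.Injective (topEntry h) := (entries_injective h).comp Sum.inl_injective
  have hbot : Function.Injective (bottomEntry h) := (entries_injective h).comp Sum.inr_injective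
  set O : Finset (Fin n) := Finset.univ.filter fun i => (i : ℕ) < l with hO
  set Z : Finset (Fin n) := Finset.univ.filter fun i => ¬ (i : ℕ) < l with hZ
  have hOcard : O.card = l := by simp [hO, Fin.card_filter_val_lt, hl]
  have hZcard : Z.card = n - l := by
    have := Finset.card_filter_add_card_filter_not (s := (Finset.univ : Finset (Fin n)))
      (fun i => (i : ℕ) < l)
    rw [← hO, ← hZ, hOcard, Finset.card_univ, Fintype.card_fin] at this
    omega
  have hmemO : ∀ i : Fin j, topEntry h i ∈ O := fun i => by
    simp only [hO, topEntry, Finset.mem_filter, Finset.mem_univ, true_and]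
    omega
  have hmemZ : ∀ i : Fin j, bottomEntry h i ∈ Z := fun i => by
    simp only [hZ, bottomEntry, Finset.mem_filter, Finset.mem_univ, true_and]
    omega
  have hsum := sum_powersetCard_prod_eq_eberlein htop hbot Finset.univ O Z (fun i _ => hmemO i)
    (fun i _ => hmemZ i) k
  rw [Finset.card_univ, Fintype.card_fin, hOcard, hZcard, ← Finset.sum_product'] at hsum
  rw [← hsum, distOp_apply, ← Finset.sum_filter, Int.cast_sum]
  have hones : ∀ y : WeightString n l,
      (O.filter fun i => ¬ y.1 i = 0).card + (Z.filter fun i => ¬ y.1 i = 0).card = l := by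
    intro y
    rw [hO, hZ, Finset.filter_filter, Finset.filter_filter]
    simp_rw [and_comm (b := ¬ y.1 _ = 0)]
    rw [← Finset.filter_filter, ← Finset.filter_filter, Finset.card_filter_add_card_filter_not]
    exact y.2
  have hdist : ∀ y : WeightString n l, hammingDist (frontString hl).1 y.1 =
      (O.filter fun i => y.1 i = 0).card + (Z.filter fun i => ¬ y.1 i = 0).card := by
    intro y
    rw [hammingDist, ← Finset.card_filter_add_card_filter_not (fun i : Fin n => (i : ℕ) < l),
      Finset.filter_comm, Finset.filter_comm (p := fun i => (frontString hl).1 i ≠ y.1 i)]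
    congr 2
    · refine Finset.filter_congr fun i hi => ?_
      rw [frontString_apply, if_pos (Finset.mem_filter.1 hi).2]
      omega
    · refine Finset.filter_congr fun i hi => ?_
      rw [frontString_apply, if_neg (Finset.mem_filter.1 hi).2]
      omega
  -- Equal weights force as many ones lost in `O` as gained in `Z`.
  have hiff : ∀ y : WeightString n l, hammingDist (frontString hl).1 y.1 = 2 * k ↔
      (O.filter fun i => y.1 i = 0).card = k ∧ (Z.filter fun i => ¬ y.1 i = 0).card = k := by
    intro y
    have h₁ := hones y
    have h₂ := hdist y
    have h₃ := Finset.card_filter_add_card_filter_not (s := O) (fun i => y.1 i = 0)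
    rw [hOcard] at h₃
    omega
  refine Finset.sum_bij
    (fun y _ => (O.filter fun i => y.1 i = 0, Z.filter fun i => ¬ y.1 i = 0)) ?_ ?_ ?_ ?_
  · intro y hy
    have hy := (hiff y).1 (Finset.mem_filter.1 hy).2
    exact Finset.mem_product.2 ⟨Finset.mem_powersetCard.2 ⟨Finset.filter_subset _ _, hy.1⟩,
      Finset.mem_powersetCard.2 ⟨Finset.filter_subset _ _, hy.2⟩⟩
  · intro y _ y' _ heq
    have heq := Prod.mk.inj heq
    ext i
    by_cases hi : (i : ℕ) < l
    · have := Finset.filter_inj'.1 heq.1 (show i ∈ O by simpa [hO] using hi)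
      omega
    · have := Finset.filter_inj'.1 heq.2 (show i ∈ Z by simpa [hZ] using hi)
      omega
  · rintro ⟨F, G⟩ hFG
    obtain ⟨hF, hG⟩ := Finset.mem_product.1 hFG
    obtain ⟨hFO, hFk⟩ := Finset.mem_powersetCard.1 hF
    obtain ⟨hGZ, hGk⟩ := Finset.mem_powersetCard.1 hG
    have hFlt : ∀ i ∈ F, (i : ℕ) < l := fun i hi => (Finset.mem_filter.1 (hFO hi)).2
    have hGlt : ∀ i ∈ G, ¬ (i : ℕ) < l := fun i hi => (Finset.mem_filter.1 (hGZ hi)).2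
    -- The preimage of `(F, G)` has its ones on `O \ F ∪ G`, so its weight is `l - k + k`.
    have hy : hammingNorm (fun i => if i ∈ O \ F ∪ G then (1 : Fin 2) else 0) = l := by
      have hdis : Disjoint (O \ F) G := Finset.disjoint_left.2 fun i hi hi' =>
        hGlt i hi' (Finset.mem_filter.1 (Finset.mem_sdiff.1 hi).1).2
      have : hammingNorm (fun i => if i ∈ O \ F ∪ G then (1 : Fin 2) else 0) =
          (O \ F ∪ G).card := by
        rw [hammingNorm]
        congr 1
        ext i
        by_cases hi : i ∈ O \ F ∪ G <;> simp only [Finset.mem_filter, hi] <;> simp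
      rw [this, Finset.card_union_of_disjoint hdis, Finset.card_sdiff_of_subset hFO, hGk]
      have := Finset.card_le_card hFO
      omega
    have hFeq : (O.filter fun i => (if i ∈ O \ F ∪ G then (1 : Fin 2) else 0) = 0) = F := by
      ext i
      have := hGlt i
      have := hFlt i
      by_cases hi : (i : ℕ) < l <;> simp [hO] <;> tauto
    have hGeq : (Z.filter fun i => ¬ (if i ∈ O \ F ∪ G then (1 : Fin 2) else 0) = 0) = G := by
      ext i
      have := hGlt i
      simp only [hO, hZ, Finset.mem_filter, Finset.mem_univ, Finset.mem_union, Finset.mem_sdiff]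
      grind
    refine ⟨⟨_, hy⟩, Finset.mem_filter.2 ⟨Finset.mem_univ _, (hiff _).2 ?_⟩, ?_⟩
    · exact ⟨(congrArg Finset.card hFeq).trans hFk, (congrArg Finset.card hGeq).trans hGk⟩
    · exact Prod.ext hFeq hGeq
  · intro y _
    rw [pairVec_apply, Int.cast_prod]
    refine Finset.prod_congr rfl fun i _ => ?_
    simp only [Finset.mem_filter, hmemO, hmemZ, true_and]
    have hval : ∀ c : Fin 2, c = 0 ∨ c = 1 := by decide
    rcases hval (y.1 (topEntry h i)) with h₁ | h₁ <;>
      rcases hval (y.1 (bottomEntry h i)) with h₂ | h₂ <;> simp [h₁, h₂]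

theorem distOp_apply_of_mem_irrepPart {n l j : ℕ} (k : ℕ) (hl : l ≤ n) (hj : j ≤ min l (n - l))
    {ψ : WeightSpace n l} (hψ : ψ ∈ irrepPart n l j) :
    distOp n l k ψ = (eigFormula n l k j : ℂ) • ψ := by
  have h : 2 * j ≤ n := by omega
  have hv : distOp n l k (pairVec (topEntry h) (bottomEntry h)) =
      (eigFormula n l k j : ℂ) • pairVec (topEntry h) (bottomEntry h) := by
    rw [eigFormula_eq_eberlein k hj, ← distOp_pairVec_frontString k hl hj h]
    refine eq_smul_pairVec hl hj h (fun i => ?_) fun a b ha hb => ?_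
    · rw [← distOp_permOp, pairAntisymm_pairVec (entries_injective h) i, map_neg]
    · rw [← distOp_permOp, symmOff_pairVec _ _ a b ha hb]
  have hle : irrepPart n l j ≤
      LinearMap.eqLocus (distOp n l k) ((eigFormula n l k j : ℂ) • LinearMap.id) := by
    rw [irrepPart_eq_span hl hj h, Submodule.span_le]
    rintro _ ⟨π, rfl⟩
    rw [SetLike.mem_coe, LinearMap.mem_eqLocus]
    simp [distOp_permOp, hv]
  exact hle hψ

/-! ### Orthogonality and the spectrum -/

theorem inner_eq_zero_of_distOp_eq {n l j : ℕ} (k : ℕ) (hl : l ≤ n) (hj : j ≤ min l (n - l))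
    {w ψ : WeightSpace n l} (hw : w ∈ irrepPart n l j) {μ : ℂ} (hψ : distOp n l k ψ = μ • ψ)
    (hμ : μ ≠ (eigFormula n l k j : ℂ)) : inner ℂ w ψ = 0 := by
  have hsymm := distOp_isSymmetric n l k w ψ
  rw [distOp_apply_of_mem_irrepPart k hl hj hw, hψ, inner_smul_left, inner_smul_right,
    map_intCast] at hsymm
  by_contra hne
  exact hμ (mul_right_cancel₀ hne hsymm).symm

/-- Here `α_1(j) = (l-j)(n-l-j) - j`, and `α_1(j) - α_1(i) = (i-j)(n+1-i-j)`, whose last factor is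
positive because `i ≤ l` and `j ≤ n - l`. -/
theorem eigFormula_one_injOn {n l i j : ℕ} (hi : i ≤ min l (n - l)) (hj : j ≤ min l (n - l))
    (hij : eigFormula n l 1 i = eigFormula n l 1 j) : i = j := by
  rw [eigFormula_eq_eberlein 1 hi, eigFormula_eq_eberlein 1 hj, eberlein_one_right,
    eberlein_one_right] at hij
  rw [le_min_iff] at hi hj
  generalize n - l = m at *
  push_cast [Nat.cast_sub hi.1, Nat.cast_sub hi.2, Nat.cast_sub hj.1, Nat.cast_sub hj.2] at hij
  have hprod : ((i : ℤ) - j) * (l + m + 1 - i - j) = 0 := by linear_combination -hij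
  rcases mul_eq_zero.1 hprod with h | h <;> omega

/-- The operator with `k = 1` separates the parts; for other `k` the eigenvalues may coincide. -/
theorem isOrtho_irrepPart {n l i j : ℕ} (hl : l ≤ n) (hi : i ≤ min l (n - l))
    (hj : j ≤ min l (n - l)) (hij : i ≠ j) :
    (irrepPart n l i).IsOrtho (irrepPart n l j) := by
  rw [Submodule.isOrtho_iff_inner_eq]
  intro u hu w hw
  exact inner_eq_zero_of_distOp_eq 1 hl hi hu (distOp_apply_of_mem_irrepPart 1 hl hj hw)
    fun h => hij (eigFormula_one_injOn hi hj (Int.cast_injective h).symm)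

theorem distOp_eq_sum_starProjection {n l : ℕ} (k : ℕ) (hl : l ≤ n) :
    distOp n l k = ∑ j ∈ Finset.range (min l (n - l) + 1), (eigFormula n l k j : ℂ) •
      ((irrepPart n l j).starProjection : WeightSpace n l →ₗ[ℂ] WeightSpace n l) := by
  rw [← LinearMap.eqLocus_eq_top, eq_top_iff, ← iSup_irrepPart hl, iSup₂_le_iff]
  intro i hi ψ hψ
  have hi' : i ≤ min l (n - l) := Nat.lt_succ_iff.1 (Finset.mem_range.1 hi)
  rw [LinearMap.mem_eqLocus, distOp_apply_of_mem_irrepPart k hl hi' hψ, LinearMap.sum_apply,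
    Finset.sum_eq_single_of_mem i hi]
  · rw [LinearMap.smul_apply, ContinuousLinearMap.coe_coe,
      Submodule.starProjection_eq_self_iff.2 hψ]
  · intro j hj hne
    have hj' : j ≤ min l (n - l) := Nat.lt_succ_iff.1 (Finset.mem_range.1 hj)
    rw [LinearMap.smul_apply, ContinuousLinearMap.coe_coe,
      (Submodule.starProjection_apply_eq_zero_iff _).2
        ((isOrtho_irrepPart hl hi' hj' hne.symm) hψ), smul_zero]

/-- An eigenvector for any other value would be orthogonal to every `B_j`, hence zero. -/
theorem hasEigenvalue_distOp_iff {n l : ℕ} (k : ℕ) (hl : l ≤ n) (μ : ℂ) :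
    Module.End.HasEigenvalue (distOp n l k) μ ↔
      ∃ j ≤ min l (n - l), μ = (eigFormula n l k j : ℂ) := by
  constructor
  · intro hμ
    obtain ⟨ψ, hψ⟩ := hμ.exists_hasEigenvector
    by_contra! hne
    exact hψ.2 (eq_zero_of_orthogonal_irrepPart hl fun j hj w hw =>
      inner_eq_zero_of_distOp_eq k hl hj hw hψ.apply_eq_smul (hne j hj))
  · rintro ⟨j, hj, rfl⟩
    obtain ⟨ψ, hψ, hne⟩ := Submodule.exists_mem_ne_zero_of_ne_bot (irrepPart_ne_bot hl hj)
    exact Module.End.hasEigenvalue_of_hasEigenvector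
      ⟨Module.End.mem_eigenspace_iff.2 (distOp_apply_of_mem_irrepPart k hl hj hψ), hne⟩

/-- `H_l^{(n)}` is the orthogonal direct sum of its nonzero parts `B_j`, `0 ≤ j ≤ min(l, n-l)`,
on which `A_k^{(l)}` acts as the scalar `α_k(j)`, and these numbers are exactly the eigenvalues of
`A_k^{(l)}`. -/
theorem mainTheorem3 (n l k : ℕ) (hl : l ≤ n) :
    (∀ j ≤ min l (n - l), irrepPart n l j ≠ ⊥) ∧
    (∀ i ≤ min l (n - l), ∀ j ≤ min l (n - l), i ≠ j →
      (irrepPart n l i).IsOrtho (irrepPart n l j)) ∧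
    (⨆ j ∈ Finset.range (min l (n - l) + 1), irrepPart n l j) = ⊤ ∧
    (∀ j ≤ min l (n - l), ∀ ψ ∈ irrepPart n l j,
      distOp n l k ψ = (eigFormula n l k j : ℂ) • ψ) ∧
    distOp n l k = ∑ j ∈ Finset.range (min l (n - l) + 1),
      (eigFormula n l k j : ℂ) •
        ((irrepPart n l j).starProjection : WeightSpace n l →ₗ[ℂ] WeightSpace n l) ∧
    (∀ μ : ℂ, Module.End.HasEigenvalue (distOp n l k) μ ↔
      ∃ j ≤ min l (n - l), μ = (eigFormula n l k j : ℂ)) := by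
  exact ⟨fun j hj => irrepPart_ne_bot hl hj,
    fun i hi j hj hij => isOrtho_irrepPart hl hi hj hij, iSup_irrepPart hl,
    fun j hj ψ hψ => distOp_apply_of_mem_irrepPart k hl hj hψ,
    distOp_eq_sum_starProjection k hl, hasEigenvalue_distOp_iff k hl⟩
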